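/- Let $\mathfrak g$ be a real Lie algebra of dimension $2n$. Suppose that $\mathfrak g$ is unimodular, i.e. $\operatorname{tr}(\mathrm{ad}_X)=0$ for every $X\in\mathfrak g$, and completely solvable, i.e. for every $X\in\mathfrak g$ all (complex) eigenvalues of $\mathrm{ad}_X$ are real. Let $J$ be a complex structure on $\mathfrak g$, i.e. a linear map $J:\mathfrak g\to\mathfrak g$ with $J^2=-\mathrm{id}$ and $[JX,JY]=[X,Y]+J[JX,Y]+J[X,JY]$ for all $X,Y\in\mathfrak g$, and let $\Omega$ be a symplectic form on $\mathfrak g$, i.e. a nondegenerate alternating bilinear form $\Omega:\mathfrak g\times\mathfrak g\to\mathbb R$ with $\Omega([X,Y],Z)+\Omega([Y,Z],X)+\Omega([Z,X],Y)=0$ for all $X,Y,Z\in\mathfrak g$. If $\Omega$ tames $J$, i.e. $\Omega(X,JX)>0$ for every nonzero $X\in\mathfrak g$, then $\mathfrak g$ is abelian. -/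

import Mathlib

/-- A real Lie algebra is unimodular if every adjoint map has trace zero. -/
def IsUnimodularLie (𝔤 : Type*) [LieRing 𝔤] [LieAlgebra ℝ 𝔤] : Prop :=
  ∀ X : 𝔤, LinearMap.trace ℝ 𝔤 (LieAlgebra.ad ℝ 𝔤 X) = 0

/-- A real Lie algebra is completely solvable if all the complex eigenvalues of every adjoint map
(that is, the eigenvalues of its complexification) are real. -/
def IsCompletelySolvableLie (𝔤 : Type*) [LieRing 𝔤] [LieAlgebra ℝ 𝔤] : Prop :=
  ∀ (X : 𝔤) (z : ℂ),
    Module.End.HasEigenvalue ((LieAlgebra.ad ℝ 𝔤 X : 𝔤 →ₗ[ℝ] 𝔤).baseChange ℂ) z → z.im = 0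

/-- The Chevalley-Eilenberg differential (with trivial coefficients) of a 2-form, evaluated on
three vectors. -/
def dTwoForm {𝔤 : Type*} [LieRing 𝔤] [LieAlgebra ℝ 𝔤] (Ω : LinearMap.BilinForm ℝ 𝔤)
    (X Y Z : 𝔤) : ℝ :=
  -Ω ⁅X, Y⁆ Z + Ω ⁅X, Z⁆ Y - Ω ⁅Y, Z⁆ X

/-- A symplectic form on a real Lie algebra: a closed, nondegenerate 2-form. -/
structure IsSymplecticForm {𝔤 : Type*} [LieRing 𝔤] [LieAlgebra ℝ 𝔤]
    (Ω : LinearMap.BilinForm ℝ 𝔤) : Prop where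
  isAlt : Ω.IsAlt
  nondegenerate : Ω.Nondegenerate
  closed : ∀ X Y Z : 𝔤, dTwoForm Ω X Y Z = 0

/-- An (integrable) complex structure on a real Lie algebra: a linear endomorphism with square
`-1` and vanishing Nijenhuis tensor. -/
structure IsComplexStructure {𝔤 : Type*} [LieRing 𝔤] [LieAlgebra ℝ 𝔤]
    (J : 𝔤 →ₗ[ℝ] 𝔤) : Prop where
  sq_eq_neg : ∀ X : 𝔤, J (J X) = -X
  integrable : ∀ X Y : 𝔤, ⁅J X, J Y⁆ - ⁅X, Y⁆ - J ⁅J X, Y⁆ - J ⁅X, J Y⁆ = 0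

/-- The 2-form `Ω` tames `J`. -/
def Tames {𝔤 : Type*} [LieRing 𝔤] [LieAlgebra ℝ 𝔤] (Ω : LinearMap.BilinForm ℝ 𝔤)
    (J : 𝔤 →ₗ[ℝ] 𝔤) : Prop :=
  ∀ X : 𝔤, X ≠ 0 → 0 < Ω X (J X)

/-!
Complete solvability makes the Killing form positive semidefinite. Each `ad X` is skew for it and
has real eigenvalues, hence takes values in its radical; so the Lie algebra is solvable by Cartan's
criterion, and by Lie's theorem there is a common eigenvector `Z` of the adjoint maps, say
`⁅X, Z⁆ = χ X • Z`. The symplectic reduction along `Z`, realized on the `J`-invariant complement of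
`Z` and `J Z`, satisfies the same hypotheses, so by induction on the dimension it is abelian.

The Jacobi identity then forces `χ` to vanish on the reduction, and the operator `δ` induced there
by `ad (J Z)` commutes with the complex structure. For the inner product obtained by symmetrizing
`Ω(·, J ·)`, closedness of `Ω` gives `⟪w, δ (δ w)⟫ + ‖δ w‖² = ℓ ⟪w, δ w⟫` with `ℓ = χ (J Z)`, while
unimodularity gives `tr δ = -ℓ`. Summing over an orthonormal basis, `tr (δ²) + ‖δ‖² = -ℓ²`. Since
`δ` has real eigenvalues, `tr (δ²) ≥ 0`; hence `δ = 0` and `ℓ = 0`, and all brackets vanish.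
-/

open Module Polynomial

section Triangularizable

variable {K V V' : Type*} [Field K] [AddCommGroup V] [Module K V] [AddCommGroup V'] [Module K V']

theorem ker_aeval_le_iSup_maxGenEigenspace (T : End K V) {p : K[X]} (h0 : p ≠ 0)
    (hp : p.Splits) : LinearMap.ker (aeval T p) ≤ ⨆ μ, T.maxGenEigenspace μ := by
  induction p using UniqueFactorizationMonoid.induction_on_coprime with
  | h0 => exact absurd rfl h0
  | @h1 u hu =>
    have hbot : LinearMap.ker (aeval T u) = ⊥ :=
      LinearMap.ker_eq_bot.2 ((End.isUnit_iff _).1 (hu.map (aeval T))).injective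
    exact hbot ▸ bot_le
  | @hpr q i hq =>
    rcases eq_or_ne i 0 with rfl | hi
    · simp [End.one_eq_id]
    have hdeg : q.degree = 1 :=
      (hp.of_dvd h0 (dvd_pow_self q hi)).degree_eq_one_of_irreducible hq.irreducible
    obtain ⟨a, ha⟩ := exists_root_of_degree_eq_one hdeg
    obtain ⟨r, hr⟩ : q ^ i ∣ (X - C a) ^ i := pow_dvd_pow_of_dvd
      ((irreducible_X_sub_C a).dvd_symm hq.irreducible (dvd_iff_isRoot.2 ha)) i
    refine le_iSup_of_le a fun v hv => (T.mem_maxGenEigenspace a v).2 ⟨i, ?_⟩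
    have haeval : aeval T ((X - C a) ^ i) = (T - a • 1) ^ i := by
      simp [Algebra.algebraMap_eq_smul_one]
    rw [← haeval, hr, mul_comm, map_mul, End.mul_apply, LinearMap.mem_ker.1 hv, map_zero]
  | @hcp q r hqr ihq ihr =>
    rw [← sup_ker_aeval_eq_ker_aeval_mul_of_coprime T hqr.isCoprime]
    exact sup_le (ihq (left_ne_zero_of_mul h0) (hp.of_dvd h0 (dvd_mul_right q r)))
      (ihr (right_ne_zero_of_mul h0) (hp.of_dvd h0 (dvd_mul_left r q)))

theorem iSup_maxGenEigenspace_eq_top_of_splits_charpoly [FiniteDimensional K V] {T : End K V}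
    (hT : T.charpoly.Splits) : ⨆ μ, T.maxGenEigenspace μ = ⊤ := by
  have hker := ker_aeval_le_iSup_maxGenEigenspace T T.charpoly_monic.ne_zero hT
  rwa [T.aeval_self_charpoly, LinearMap.ker_zero, top_le_iff] at hker

theorem map_maxGenEigenspace_le {T : End K V} {T' : End K V'} {p : V →ₗ[K] V'}
    (hp : p ∘ₗ T = T' ∘ₗ p) (μ : K) :
    (T.maxGenEigenspace μ).map p ≤ T'.maxGenEigenspace μ := by
  have hpμ : p ∘ₗ (T - μ • 1) = (T' - μ • 1) ∘ₗ p := by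
    rw [LinearMap.comp_sub, LinearMap.sub_comp, hp]
    ext
    simp
  rintro _ ⟨v, hv, rfl⟩
  obtain ⟨k, hk⟩ := (T.mem_maxGenEigenspace μ v).1 hv
  refine (T'.mem_maxGenEigenspace μ _).2 ⟨k, ?_⟩
  rw [← LinearMap.comp_apply, End.commute_pow_left_of_commute hpμ.symm,
    LinearMap.comp_apply, hk, map_zero]

theorem iSup_maxGenEigenspace_eq_top_of_surjective {T : End K V} {T' : End K V'}
    {p : V →ₗ[K] V'} (hp : p ∘ₗ T = T' ∘ₗ p) (hsurj : Function.Surjective p)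
    (hT : ⨆ μ, T.maxGenEigenspace μ = ⊤) : ⨆ μ, T'.maxGenEigenspace μ = ⊤ := by
  rw [eq_top_iff, ← LinearMap.range_eq_top.2 hsurj, ← Submodule.map_top, ← hT, Submodule.map_iSup]
  exact iSup_mono (map_maxGenEigenspace_le hp)

theorem iSup_maxGenEigenspace_eq_top_of_subquotient [FiniteDimensional K V] {T : End K V}
    {T' : End K V'} {N : Submodule K V} (hN : ∀ v ∈ N, T v ∈ N) {p : V →ₗ[K] V'}
    (hp : ∀ v ∈ N, p (T v) = T' (p v)) (hsurj : ∀ w, ∃ v ∈ N, p v = w)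
    (hT : ⨆ μ, T.maxGenEigenspace μ = ⊤) : ⨆ μ, T'.maxGenEigenspace μ = ⊤ := by
  refine iSup_maxGenEigenspace_eq_top_of_surjective (p := p.domRestrict N) (T := T.restrict hN)
    (LinearMap.ext fun v => hp v v.2) (fun w => ?_) (End.genEigenspace_restrict_eq_top hN hT)
  obtain ⟨v, hv, rfl⟩ := hsurj w
  exact ⟨⟨v, hv⟩, rfl⟩

theorem trace_comp_self_nonneg [LinearOrder K] [IsStrictOrderedRing K] [FiniteDimensional K V]
    {T : End K V} (hT : ⨆ μ, T.maxGenEigenspace μ = ⊤) :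
    0 ≤ LinearMap.trace K V (T ∘ₗ T) := by
  classical
  have hinternal := DirectSum.isInternal_submodule_of_iSupIndep_of_iSup_eq_top
    T.independent_maxGenEigenspace hT
  have hfinite : {μ | T.maxGenEigenspace μ ≠ ⊥}.Finite :=
    WellFoundedGT.finite_ne_bot_of_iSupIndep T.independent_maxGenEigenspace
  have hmaps := fun μ => T.mapsTo_maxGenEigenspace_of_comm (Commute.refl T) μ
  rw [LinearMap.trace_eq_sum_trace_restrict' hinternal hfinite
    fun μ => show Set.MapsTo (T ∘ₗ T) _ _ from (hmaps μ).comp (hmaps μ)]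
  refine Finset.sum_nonneg fun μ _ => ?_
  have hnil : IsNilpotent (T.restrict (hmaps μ) - algebraMap K _ μ) :=
    T.isNilpotent_restrict_maxGenEigenspace_sub_algebraMap μ
  have htrace : LinearMap.trace K _ (T.restrict (hmaps μ)) =
      μ * finrank K (T.maxGenEigenspace μ) := by
    rw [← LinearMap.trace_one, ← LinearMap.trace_comp_eq_mul_of_commute_of_isNilpotent μ
      (Commute.one_left _) hnil]
    rfl
  rw [LinearMap.restrict_comp (hmaps μ) (hmaps μ),
    LinearMap.trace_comp_eq_mul_of_commute_of_isNilpotent μ (Commute.refl _) hnil, htrace,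
    ← mul_assoc]
  exact mul_nonneg (mul_self_nonneg μ) (Nat.cast_nonneg _)

section Skew

variable [LinearOrder K] [IsStrictOrderedRing K] {B : LinearMap.BilinForm K V} {T : End K V}

theorem mem_ker_of_apply_self_eq_zero (hB : B.IsPosSemidef) {v : V} (hv : B v v = 0) :
    v ∈ LinearMap.ker B :=
  (B.apply_apply_same_eq_zero_iff hB.nonneg ⟨hB.eq⟩).1 hv

theorem apply_mem_ker_of_sub_smul_apply_mem_ker (hB : B.IsPosSemidef)
    (hskew : ∀ x y, B (T x) y = -B x (T y)) {a : K} {v : V}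
    (hv : (T - a • 1) v ∈ LinearMap.ker B) : T v ∈ LinearMap.ker B := by
  have hskew_self : B (T v) v = 0 := by linarith [hskew v v, hB.eq v (T v)]
  have hsq : B ((T - a • 1) v) ((T - a • 1) v) = B (T v) (T v) + a ^ 2 * B v v := by
    simp only [LinearMap.sub_apply, LinearMap.smul_apply, End.one_apply, map_sub, map_smul,
      smul_eq_mul, hskew_self, hB.eq v (T v)]
    ring
  rw [LinearMap.mem_ker.1 hv, LinearMap.zero_apply] at hsq
  exact mem_ker_of_apply_self_eq_zero hB
    (by nlinarith [hB.nonneg (T v), mul_nonneg (sq_nonneg a) (hB.nonneg v)])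

theorem apply_mem_ker_of_sub_smul_pow_apply_mem_ker (hB : B.IsPosSemidef)
    (hskew : ∀ x y, B (T x) y = -B x (T y)) {a : K} {k : ℕ} {v : V}
    (hv : ((T - a • 1) ^ k) v ∈ LinearMap.ker B) : T v ∈ LinearMap.ker B := by
  induction k generalizing v with
  | zero =>
    refine mem_ker_of_apply_self_eq_zero hB ?_
    rw [hskew, show B v = 0 from hv, LinearMap.zero_apply, neg_zero]
  | succ k ih =>
    rw [pow_succ', End.mul_apply] at hv
    have hTv := apply_mem_ker_of_sub_smul_apply_mem_ker hB hskew hv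
    have hcomm : Commute T ((T - a • 1) ^ k) :=
      ((Commute.refl T).sub_right ((Commute.one_right T).smul_right a)).pow_right k
    rw [← End.mul_apply, hcomm.eq, End.mul_apply] at hTv
    have hTTv : B (T (T v)) = 0 := ih hTv
    refine mem_ker_of_apply_self_eq_zero hB ?_
    rw [hB.eq, ← neg_neg (B _ _), ← hskew, hTTv, LinearMap.zero_apply, neg_zero]

theorem apply_mem_ker_of_skew (hB : B.IsPosSemidef) (hskew : ∀ x y, B (T x) y = -B x (T y))
    (hT : ⨆ μ, T.maxGenEigenspace μ = ⊤) (x : V) : T x ∈ LinearMap.ker B := by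
  suffices ⨆ μ, T.maxGenEigenspace μ ≤ (LinearMap.ker B).comap T from
    this (hT ▸ Submodule.mem_top)
  refine iSup_le fun μ v hv => ?_
  obtain ⟨k, hk⟩ := (T.mem_maxGenEigenspace μ v).1 hv
  exact apply_mem_ker_of_sub_smul_pow_apply_mem_ker hB hskew (hk ▸ Submodule.zero_mem _)

end Skew

end Triangularizable

theorem iSup_maxGenEigenspace_eq_top_of_complex_eigenvalues_real {V : Type*} [AddCommGroup V]
    [Module ℝ V] [FiniteDimensional ℝ V] {T : End ℝ V}
    (h : ∀ z : ℂ, End.HasEigenvalue (T.baseChange ℂ : End ℂ _) z → z.im = 0) :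
    ⨆ μ, T.maxGenEigenspace μ = ⊤ := by
  refine iSup_maxGenEigenspace_eq_top_of_splits_charpoly
    (Splits.of_splits_map (algebraMap ℝ ℂ) (IsAlgClosed.splits _) fun z hz => ?_)
  rw [← LinearMap.charpoly_baseChange] at hz
  have heig := (End.hasEigenvalue_iff_isRoot_charpoly _ z).2 (isRoot_of_mem_roots hz)
  exact ⟨z.re, Complex.ext rfl (h z heig).symm⟩

open scoped RealInnerProductSpace in
theorem eq_zero_of_inner_apply_apply_add_norm_sq {E : Type*} [NormedAddCommGroup E]
    [InnerProductSpace ℝ E] [FiniteDimensional ℝ E] {D : End ℝ E}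
    (hD : ⨆ μ, D.maxGenEigenspace μ = ⊤) {r : ℝ}
    (h : ∀ x, ⟪x, D (D x)⟫ + ‖D x‖ ^ 2 = r * ⟪x, D x⟫) (hr : r * LinearMap.trace ℝ E D ≤ 0) :
    D = 0 := by
  let b := stdOrthonormalBasis ℝ E
  have hsum : LinearMap.trace ℝ E (D ∘ₗ D) + ∑ i, ‖D (b i)‖ ^ 2 = r * LinearMap.trace ℝ E D := by
    simp only [LinearMap.trace_eq_sum_inner _ b, LinearMap.comp_apply,
      ← Finset.sum_add_distrib, Finset.mul_sum, h]
  have hzero : ∑ i, ‖D (b i)‖ ^ 2 = 0 :=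
    le_antisymm (by linarith [trace_comp_self_nonneg hD])
      (Finset.sum_nonneg fun _ _ => sq_nonneg _)
  rw [Finset.sum_eq_zero_iff_of_nonneg fun _ _ => sq_nonneg _] at hzero
  exact b.toBasis.ext fun i => by simpa using hzero i (Finset.mem_univ i)

section Solvable

variable (K L : Type*) [Field K] [LinearOrder K] [IsStrictOrderedRing K] [LieRing L]
  [LieAlgebra K L] [FiniteDimensional K L] [LieModule.IsTriangularizable K L L]

theorem isPosSemidef_killingForm : (killingForm K L).IsPosSemidef where
  eq x y := LieModule.traceForm_comm K L L x y
  nonneg x := trace_comp_self_nonneg (T := LieAlgebra.ad K L x)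
    (LieModule.IsTriangularizable.maxGenEigenspace_eq_top x)

include K in
theorem isSolvable_of_isTriangularizable : LieAlgebra.IsSolvable L := by
  have hlie : ∀ x y : L, ⁅x, y⁆ ∈ LinearMap.ker (killingForm K L) := fun x y =>
    apply_mem_ker_of_skew (T := LieAlgebra.ad K L x) (isPosSemidef_killingForm K L)
      (LieModule.traceForm_apply_lie_apply' K L L x)
      (LieModule.IsTriangularizable.maxGenEigenspace_eq_top x) y
  have hspan : Submodule.span K {⁅x, y⁆ | (x : L) (y : L)} ≤ LinearMap.ker (killingForm K L) :=
    Submodule.span_le.2 (by rintro _ ⟨x, y, rfl⟩; exact hlie x y)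
  refine LieAlgebra.isSolvable_of_killingForm_apply_lie_eq_zero (R := K) fun x y hy => ?_
  have hy' : y ∈ Submodule.span K {⁅x, y⁆ | (x : L) (y : L)} := by
    rwa [← LieAlgebra.coe_derivedSeries_one_eq]
  rw [LieModule.traceForm_comm, LinearMap.mem_ker.1 (hspan hy'), LinearMap.zero_apply]

theorem exists_common_eigenvector_of_isTriangularizable [Nontrivial L] :
    ∃ Z : L, Z ≠ 0 ∧ ∃ χ : Dual K L, ∀ X : L, ⁅X, Z⁆ = χ X • Z := by
  have := isSolvable_of_isTriangularizable K L
  obtain ⟨χ, hχ⟩ := LieModule.exists_nontrivial_weightSpace_of_isSolvable K L L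
  obtain ⟨⟨Z, hZ⟩, hZ0⟩ := exists_ne (0 : LieModule.weightSpace L χ)
  exact ⟨Z, fun h => hZ0 (Subtype.ext h), χ, (LieModule.mem_weightSpace χ Z).1 hZ⟩

end Solvable

theorem nondegenerate_of_tames {L : Type*} [LieRing L] [LieAlgebra ℝ L]
    {Ω : LinearMap.BilinForm ℝ L} {J : L →ₗ[ℝ] L} (hΩ : Ω.IsAlt) (h : Tames Ω J) :
    Ω.Nondegenerate := by
  refine hΩ.isRefl.nondegenerate_iff_separatingLeft.2 fun X hX => ?_
  by_contra hX0
  exact (h X hX0).ne' (hX (J X))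

/-- The inner product obtained by symmetrizing `Ω(·, J ·)`, for a form `Ω` taming `J`. -/
noncomputable abbrev Tames.innerProductCore {L : Type*} [LieRing L] [LieAlgebra ℝ L]
    {Ω : LinearMap.BilinForm ℝ L} {J : L →ₗ[ℝ] L} (h : Tames Ω J) :
    InnerProductSpace.Core ℝ L where
  inner X Y := (Ω X (J Y) + Ω Y (J X)) / 2
  conj_inner_symm X Y := by simp [add_comm]
  re_inner_nonneg X := by
    rcases eq_or_ne X 0 with rfl | hX
    · simp
    · simpa using (h X hX).le
  add_left X Y Z := by simp; ring
  smul_left X Y a := by simp; ring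
  definite X hX := by
    by_contra hX0
    exact (h X hX0).ne' (by simpa using hX)

/-- A common eigenvector `Z` of the adjoint maps of a Lie algebra, with eigenvalue functional `χ`,
together with a symplectic form `Ω` taming a complex structure `J`: the input of the symplectic
reduction along the line spanned by `Z`. -/
structure TamedEigenvector (L : Type*) [LieRing L] [LieAlgebra ℝ L] where
  Ω : LinearMap.BilinForm ℝ L
  J : L →ₗ[ℝ] L
  symplectic : IsSymplecticForm Ω
  complex : IsComplexStructure J
  tames : Tames Ω J
  Z : L
  ne_zero : Z ≠ 0
  χ : Dual ℝ L
  lie_Z : ∀ X : L, ⁅X, Z⁆ = χ X • Z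

namespace TamedEigenvector

variable {L : Type*} [LieRing L] [LieAlgebra ℝ L] (E : TamedEigenvector L)

/-- The functional `Ω(Z, ·)`, normalized to take the value `1` at `J Z`. -/
noncomputable def τ : Dual ℝ L := (E.Ω E.Z (E.J E.Z))⁻¹ • E.Ω E.Z

theorem Ω_Z_J_Z_pos : 0 < E.Ω E.Z (E.J E.Z) := E.tames E.Z E.ne_zero

@[simp] theorem τ_Z : E.τ E.Z = 0 := by simp [τ, E.symplectic.isAlt E.Z]

@[simp] theorem τ_J_Z : E.τ (E.J E.Z) = 1 := by simp [τ, E.Ω_Z_J_Z_pos.ne']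

@[simp] theorem J_J (X : L) : E.J (E.J X) = -X := E.complex.sq_eq_neg X

theorem τ_lie (X Y : L) : E.τ ⁅X, Y⁆ = E.χ Y * E.τ X - E.χ X * E.τ Y := by
  have hclosed := E.symplectic.closed X Y E.Z
  simp only [dTwoForm, E.lie_Z, map_smul, LinearMap.smul_apply, smul_eq_mul,
    ← E.symplectic.isAlt.neg_eq E.Z ⁅X, Y⁆] at hclosed
  simp only [τ, LinearMap.smul_apply, smul_eq_mul]
  linear_combination (E.Ω E.Z (E.J E.Z))⁻¹ * hclosed

theorem Z_lie (X : L) : ⁅E.Z, X⁆ = -E.χ X • E.Z := by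
  rw [← lie_skew, E.lie_Z, neg_smul]

@[simp] theorem χ_lie (X Y : L) : E.χ ⁅X, Y⁆ = 0 := by
  have hjacobi := leibniz_lie X Y E.Z
  simp only [E.lie_Z, lie_smul, smul_smul] at hjacobi
  rw [mul_comm, right_eq_add] at hjacobi
  exact (smul_eq_zero.1 hjacobi).resolve_right E.ne_zero

@[simp] theorem χ_Z : E.χ E.Z = 0 :=
  (smul_eq_zero.1 ((E.lie_Z E.Z).symm.trans (lie_self E.Z))).resolve_right E.ne_zero

/-- The symplectic reduction of `L` along the line spanned by `Z`, realized as the largest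
`J`-invariant subspace of the hyperplane `Ω(Z, ·) = 0`. This is a complement of the span of `Z` and
`J Z`, but not in general a Lie subalgebra of `L`. -/
noncomputable def reduction : Submodule ℝ L := LinearMap.ker E.τ ⊓ LinearMap.ker (E.τ ∘ₗ E.J)

variable {E} in
theorem mem_reduction {X : L} : X ∈ E.reduction ↔ E.τ X = 0 ∧ E.τ (E.J X) = 0 := Iff.rfl

@[simp] theorem τ_coe (w : E.reduction) : E.τ w = 0 := w.2.1

@[simp] theorem τ_J_coe (w : E.reduction) : E.τ (E.J w) = 0 := w.2.2

theorem Ω_Z_coe (w : E.reduction) : E.Ω E.Z w = 0 := by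
  simpa [τ, E.Ω_Z_J_Z_pos.ne'] using E.τ_coe w

/-- The projection of `L` onto the reduction along the span of `Z` and `J Z`. -/
noncomputable def proj : L →ₗ[ℝ] E.reduction :=
  (LinearMap.id - (E.τ ∘ₗ E.J).smulRight E.Z - E.τ.smulRight (E.J E.Z)).codRestrict E.reduction
    fun X => mem_reduction.2 (by simp)

theorem coe_proj (X : L) : (E.proj X : L) = X - E.τ (E.J X) • E.Z - E.τ X • E.J E.Z := rfl

theorem eq_proj_add (X : L) : X = E.proj X + E.τ (E.J X) • E.Z + E.τ X • E.J E.Z := by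
  rw [coe_proj]
  module

@[simp] theorem proj_coe (w : E.reduction) : E.proj w = w :=
  Subtype.ext (by simp [coe_proj])

@[simp] theorem proj_Z : E.proj E.Z = 0 := Subtype.ext (by simp [coe_proj])

@[simp] theorem proj_J_Z : E.proj (E.J E.Z) = 0 := Subtype.ext (by simp [coe_proj])

/-- The complex structure of the reduction. -/
noncomputable def j : End ℝ E.reduction :=
  E.J.restrict fun X hX => mem_reduction.2 ⟨hX.2, by simp [(mem_reduction.1 hX).1]⟩

@[simp] theorem coe_j (w : E.reduction) : (E.j w : L) = E.J w := rfl

theorem j_j (w : E.reduction) : E.j (E.j w) = -w := Subtype.ext (by simp)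

theorem proj_J (X : L) : E.proj (E.J X) = E.j (E.proj X) :=
  Subtype.ext (by simp only [coe_proj, coe_j, map_sub, map_smul, J_J, map_neg]; module)

theorem proj_lie_proj {X Y : L} (hY : E.τ Y = 0) : E.proj ⁅X, (E.proj Y : L)⁆ = E.proj ⁅X, Y⁆ := by
  simp [coe_proj, hY, E.lie_Z]

theorem proj_lie_coe_proj_lie (X : L) (v w : E.reduction) :
    E.proj ⁅X, (E.proj ⁅(v : L), (w : L)⁆ : L)⁆ = E.proj ⁅X, ⁅(v : L), (w : L)⁆⁆ :=
  E.proj_lie_proj (by simp [τ_lie])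

noncomputable instance : LieRing E.reduction where
  bracket v w := E.proj ⁅(v : L), (w : L)⁆
  add_lie u v w := by simp
  lie_add u v w := by simp
  lie_self w := by simp
  leibniz_lie u v w := by
    change E.proj ⁅(u : L), (E.proj ⁅(v : L), (w : L)⁆ : L)⁆ =
      E.proj ⁅(E.proj ⁅(u : L), (v : L)⁆ : L), (w : L)⁆ +
        E.proj ⁅(v : L), (E.proj ⁅(u : L), (w : L)⁆ : L)⁆
    rw [← lie_skew (E.proj ⁅(u : L), (v : L)⁆ : L), map_neg]
    simp only [proj_lie_coe_proj_lie]
    rw [← map_neg, lie_skew, ← map_add, ← leibniz_lie]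

noncomputable instance : LieAlgebra ℝ E.reduction where
  lie_smul a v w := by
    change E.proj ⁅(v : L), a • (w : L)⁆ = a • E.proj ⁅(v : L), (w : L)⁆
    rw [lie_smul, map_smul]

theorem lie_def (v w : E.reduction) : ⁅v, w⁆ = E.proj ⁅(v : L), (w : L)⁆ := rfl

/-- The `Z`-component of the bracket of two elements of the reduction. -/
noncomputable def β (v w : E.reduction) : ℝ := E.τ (E.J ⁅(v : L), (w : L)⁆)

theorem lie_coe_coe (v w : E.reduction) : ⁅(v : L), (w : L)⁆ = ⁅v, w⁆ + E.β v w • E.Z := by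
  have hadd := E.eq_proj_add ⁅(v : L), (w : L)⁆
  simpa [τ_lie, lie_def, β] using hadd

theorem tames_reduction : Tames (E.Ω.restrict E.reduction) E.j :=
  fun w hw => E.tames w (by simpa using hw)

theorem isSymplecticForm_reduction : IsSymplecticForm (E.Ω.restrict E.reduction) := by
  have hAlt : (E.Ω.restrict E.reduction).IsAlt := fun w => E.symplectic.isAlt w
  refine ⟨hAlt, nondegenerate_of_tames hAlt E.tames_reduction, fun u v w => ?_⟩
  have hclosed := E.symplectic.closed u v w
  simpa [dTwoForm, lie_coe_coe, Ω_Z_coe] using hclosed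

theorem isComplexStructure_reduction : IsComplexStructure E.j where
  sq_eq_neg := E.j_j
  integrable v w := by
    simp only [lie_def, coe_j, ← proj_J, ← map_sub]
    rw [E.complex.integrable, map_zero]

/-- The compression of an endomorphism of `L` to the reduction. -/
noncomputable def compress (A : End ℝ L) : End ℝ E.reduction :=
  E.proj ∘ₗ A ∘ₗ E.reduction.subtype

theorem ad_eq_compress (w : E.reduction) :
    LieAlgebra.ad ℝ E.reduction w = E.compress (LieAlgebra.ad ℝ L w) := rfl

section FiniteDimensional

variable [FiniteDimensional ℝ L]

theorem finrank_reduction_lt : finrank ℝ E.reduction < finrank ℝ L := by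
  refine Submodule.finrank_lt fun htop => ?_
  have hJZ : E.J E.Z ∈ E.reduction := htop ▸ Submodule.mem_top
  exact one_ne_zero (E.τ_J_Z.symm.trans hJZ.1)

theorem trace_compress (A : End ℝ L) : LinearMap.trace ℝ E.reduction (E.compress A) =
    LinearMap.trace ℝ L A - E.τ (E.J (A E.Z)) - E.τ (A (E.J E.Z)) := by
  have hA : A ∘ₗ E.reduction.subtype ∘ₗ E.proj =
      A - (E.τ ∘ₗ E.J).smulRight (A E.Z) - E.τ.smulRight (A (E.J E.Z)) := by
    ext X
    simp [coe_proj]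
  rw [compress, LinearMap.trace_comp_comm', LinearMap.comp_assoc, hA]
  simp

theorem isUnimodularLie_reduction (hunimod : IsUnimodularLie L) :
    IsUnimodularLie E.reduction := fun w => by
  rw [ad_eq_compress, trace_compress, hunimod]
  simp [E.lie_Z, τ_lie]

theorem iSup_maxGenEigenspace_compress_ad_eq_top [LieModule.IsTriangularizable ℝ L L] {X : L}
    (hX : ∀ Y, E.τ Y = 0 → E.τ ⁅X, Y⁆ = 0) :
    ⨆ μ, (E.compress (LieAlgebra.ad ℝ L X)).maxGenEigenspace μ = ⊤ :=
  iSup_maxGenEigenspace_eq_top_of_subquotient (T := LieAlgebra.ad ℝ L X) (N := LinearMap.ker E.τ)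
    (p := E.proj) hX (fun _ hY => (E.proj_lie_proj hY).symm) (fun w => ⟨w, E.τ_coe w, E.proj_coe w⟩)
    (LieModule.IsTriangularizable.maxGenEigenspace_eq_top X)

instance [LieModule.IsTriangularizable ℝ L L] :
    LieModule.IsTriangularizable ℝ E.reduction E.reduction where
  maxGenEigenspace_eq_top w :=
    E.iSup_maxGenEigenspace_compress_ad_eq_top (X := (w : L)) fun Y hY => by simp [τ_lie, hY]

end FiniteDimensional

/-- The endomorphism of the reduction induced by `ad (J Z)`. -/
noncomputable def δ : End ℝ E.reduction := E.compress (LieAlgebra.ad ℝ L (E.J E.Z))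

theorem δ_apply (w : E.reduction) : E.δ w = E.proj ⁅E.J E.Z, (w : L)⁆ := rfl

theorem J_lie_J_Z (X : L) :
    E.J ⁅E.J E.Z, X⁆ = ⁅E.J E.Z, E.J X⁆ + E.χ X • E.Z + E.χ (E.J X) • E.J E.Z := by
  have hint := E.complex.integrable E.Z X
  simp only [Z_lie, map_smul] at hint
  rw [← sub_eq_zero, ← neg_eq_zero, ← hint]
  module

theorem δ_j (w : E.reduction) : E.δ (E.j w) = E.j (E.δ w) := by
  rw [δ_apply, δ_apply, ← proj_J, J_lie_J_Z]
  simp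

theorem J_Z_lie_coe (w : E.reduction) :
    ⁅E.J E.Z, (w : L)⁆ = E.δ w + (2 * E.χ (E.J w)) • E.Z + E.χ w • E.J E.Z := by
  have hadd := E.eq_proj_add ⁅E.J E.Z, (w : L)⁆
  simpa [J_lie_J_Z, τ_lie, δ_apply, two_mul] using hadd

theorem trace_δ [FiniteDimensional ℝ L] (hunimod : IsUnimodularLie L) :
    LinearMap.trace ℝ E.reduction E.δ = -E.χ (E.J E.Z) := by
  rw [δ, trace_compress, hunimod]
  simp [E.lie_Z]

section AbelianReduction

variable [IsLieAbelian E.reduction]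

theorem lie_coe_coe_eq_smul (v w : E.reduction) : ⁅(v : L), (w : L)⁆ = E.β v w • E.Z := by
  rw [lie_coe_coe, trivial_lie_zero, ZeroMemClass.coe_zero, zero_add]

theorem jacobi_J_Z (v w : E.reduction) :
    (E.χ (E.J E.Z) * E.β v w) • E.Z =
      (E.β (E.δ v) w + E.β v (E.δ w) + 4 * E.χ v * E.χ (E.J w) - 4 * E.χ (E.J v) * E.χ w) • E.Z +
        (E.χ v • E.δ w - E.χ w • E.δ v : E.reduction) := by
  have hjacobi := leibniz_lie (E.J E.Z) (v : L) (w : L)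
  have hskew : ⁅(v : L), E.J E.Z⁆ = -(E.δ v + (2 * E.χ (E.J v)) • E.Z + E.χ v • E.J E.Z) := by
    rw [← lie_skew, J_Z_lie_coe]
  simp only [J_Z_lie_coe, hskew, lie_coe_coe_eq_smul, add_lie, lie_add, smul_lie, lie_smul, lie_Z,
    Z_lie] at hjacobi
  rw [mul_comm, mul_smul, hjacobi]
  push_cast
  module

theorem χ_smul_δ (v w : E.reduction) : E.χ v • E.δ w = E.χ w • E.δ v := by
  have hproj := congrArg E.proj (E.jacobi_J_Z v w)
  rw [map_add, map_smul, map_smul, proj_Z, proj_coe, smul_zero, smul_zero, zero_add] at hproj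
  exact sub_eq_zero.1 hproj.symm

theorem β_δ_add_χ (v w : E.reduction) :
    E.β (E.δ v) w + E.β v (E.δ w) + 4 * E.χ v * E.χ (E.J w) - 4 * E.χ (E.J v) * E.χ w =
      E.χ (E.J E.Z) * E.β v w := by
  have hZ := congrArg (E.τ ∘ₗ E.J) (E.jacobi_J_Z v w)
  simpa using hZ.symm

@[simp] theorem χ_coe (v : E.reduction) : E.χ v = 0 := by
  by_contra hv
  have hpos : 0 < E.χ v ^ 2 + E.χ (E.J v) ^ 2 := by positivity
  have hδ : E.δ v = 0 := by
    have hv_j : E.χ v • E.j (E.δ v) = E.χ (E.J v) • E.δ v := by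
      rw [← δ_j, χ_smul_δ, coe_j]
    have hj_v : E.χ v • -E.δ v = E.χ (E.J v) • E.j (E.δ v) := by
      rw [← j_j, ← map_smul, hv_j, map_smul]
    refine (smul_eq_zero.1 ?_).resolve_left hpos.ne'
    linear_combination (norm := module) -E.χ v • hj_v - E.χ (E.J v) • hv_j
  have hℓ : E.χ (E.J E.Z) = 0 := by
    have hlie := congrArg E.χ (E.J_Z_lie_coe v)
    simpa [hδ, hv] using hlie
  have hZ := E.β_δ_add_χ v (E.j v)
  simp only [β, hδ, hℓ, δ_j, coe_j, J_J, ZeroMemClass.coe_zero, zero_lie, lie_zero, map_zero,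
    map_neg, mul_neg, add_zero, zero_add, zero_mul] at hZ
  nlinarith

theorem J_Z_lie_coe_eq_δ (w : E.reduction) : ⁅E.J E.Z, (w : L)⁆ = E.δ w := by
  rw [J_Z_lie_coe, ← coe_j, χ_coe, χ_coe]
  simp

theorem β_δ_add (v w : E.reduction) :
    E.β (E.δ v) w + E.β v (E.δ w) = E.χ (E.J E.Z) * E.β v w := by
  simpa using E.β_δ_add_χ v w

theorem Ω_δ_add (v w : E.reduction) :
    E.Ω (E.δ v) w + E.Ω v (E.δ w) = -E.Ω E.Z (E.J E.Z) * E.β v w := by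
  have hclosed := E.symplectic.closed v w (E.J E.Z)
  simp only [dTwoForm, ← lie_skew _ (E.J E.Z), J_Z_lie_coe_eq_δ, lie_coe_coe_eq_smul, map_smul,
    map_neg, LinearMap.smul_apply, LinearMap.neg_apply, smul_eq_mul] at hclosed
  rw [← E.symplectic.isAlt.neg_eq (E.δ w)]
  linear_combination -hclosed

theorem Ω_j_δ_add (w : E.reduction) :
    E.Ω w (E.j (E.δ w)) + E.Ω (E.δ w) (E.j w) = -E.Ω E.Z (E.J E.Z) * E.β w (E.j w) := by
  rw [← Ω_δ_add, δ_j, add_comm]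

/-- In terms of the inner product `⟪v, w⟫ = (Ω v (j w) + Ω w (j v)) / 2`, this says
`⟪w, δ (δ w)⟫ + ‖δ w‖ ^ 2 = χ (J Z) * ⟪w, δ w⟫`. -/
theorem Ω_j_δ_δ_add (w : E.reduction) :
    E.Ω w (E.j (E.δ (E.δ w))) + E.Ω (E.δ (E.δ w)) (E.j w) + 2 * E.Ω (E.δ w) (E.j (E.δ w)) =
      E.χ (E.J E.Z) * (E.Ω w (E.j (E.δ w)) + E.Ω (E.δ w) (E.j w)) := by
  rw [Ω_j_δ_add]
  have hleft := E.Ω_δ_add w (E.j (E.δ w))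
  have hright := E.Ω_δ_add (E.δ w) (E.j w)
  have hβ := E.β_δ_add w (E.j w)
  rw [δ_j] at hleft hright hβ
  linear_combination hleft + hright - E.Ω E.Z (E.J E.Z) * hβ

variable [FiniteDimensional ℝ L]

theorem iSup_maxGenEigenspace_δ_eq_top [LieModule.IsTriangularizable ℝ L L] :
    ⨆ μ, E.δ.maxGenEigenspace μ = ⊤ := by
  refine E.iSup_maxGenEigenspace_compress_ad_eq_top fun Y hY => ?_
  have hχY := congrArg E.χ (E.eq_proj_add Y)
  simpa [τ_lie, hY] using hχY

theorem δ_eq_zero [LieModule.IsTriangularizable ℝ L L] (hunimod : IsUnimodularLie L) :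
    E.δ = 0 := by
  let := E.tames_reduction.innerProductCore.toNormedAddCommGroup
  let := InnerProductSpace.ofCore E.tames_reduction.innerProductCore.toCore
  refine eq_zero_of_inner_apply_apply_add_norm_sq E.iSup_maxGenEigenspace_δ_eq_top
    (r := E.χ (E.J E.Z)) (fun w => ?_) ?_
  · rw [← real_inner_self_eq_norm_sq]
    change (E.Ω w (E.j (E.δ (E.δ w))) + E.Ω (E.δ (E.δ w)) (E.j w)) / 2 +
        (E.Ω (E.δ w) (E.j (E.δ w)) + E.Ω (E.δ w) (E.j (E.δ w))) / 2 =
      E.χ (E.J E.Z) * ((E.Ω w (E.j (E.δ w)) + E.Ω (E.δ w) (E.j w)) / 2)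
    linear_combination (E.Ω_j_δ_δ_add w) / 2
  · rw [E.trace_δ hunimod]
    nlinarith [sq_nonneg (E.χ (E.J E.Z))]

include E in
theorem isLieAbelian [LieModule.IsTriangularizable ℝ L L] (hunimod : IsUnimodularLie L) :
    IsLieAbelian L := by
  have hδ := E.δ_eq_zero hunimod
  have hχ (X : L) : E.χ X = 0 := by
    have htrace := E.trace_δ hunimod
    rw [hδ, map_zero, eq_comm, neg_eq_zero] at htrace
    rw [E.eq_proj_add X]
    simp [htrace]
  have hβ (v w : E.reduction) : E.β v w = 0 := by
    simpa [hδ, E.Ω_Z_J_Z_pos.ne'] using E.Ω_δ_add v w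
  have hT (w : E.reduction) : ⁅(w : L), E.J E.Z⁆ = 0 := by
    simp [← lie_skew _ (E.J E.Z), J_Z_lie_coe_eq_δ, hδ]
  refine ⟨fun X Y => ?_⟩
  rw [E.eq_proj_add X, E.eq_proj_add Y]
  simp [E.lie_Z, E.Z_lie, hχ, hT, J_Z_lie_coe_eq_δ, hδ, lie_coe_coe_eq_smul, hβ]

end AbelianReduction

end TamedEigenvector

theorem isLieAbelian_of_tames {L : Type*} [LieRing L] [LieAlgebra ℝ L] [FiniteDimensional ℝ L]
    [LieModule.IsTriangularizable ℝ L L] (hunimod : IsUnimodularLie L)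
    {Ω : LinearMap.BilinForm ℝ L} {J : L →ₗ[ℝ] L} (hΩ : IsSymplecticForm Ω)
    (hJ : IsComplexStructure J) (htame : Tames Ω J) : IsLieAbelian L := by
  induction hn : finrank ℝ L using Nat.strong_induction_on generalizing L with
  | h n ih =>
    rcases subsingleton_or_nontrivial L with hL | hL
    · exact ⟨fun _ _ => Subsingleton.elim _ _⟩
    obtain ⟨Z, hZ, χ, hχ⟩ := exists_common_eigenvector_of_isTriangularizable ℝ L
    let E : TamedEigenvector L := ⟨Ω, J, hΩ, hJ, htame, Z, hZ, χ, hχ⟩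
    have : IsLieAbelian E.reduction :=
      ih _ (hn ▸ E.finrank_reduction_lt) (E.isUnimodularLie_reduction hunimod)
        E.isSymplecticForm_reduction E.isComplexStructure_reduction E.tames_reduction rfl
    exact E.isLieAbelian hunimod

theorem theorem3p1 (n : ℕ) (𝔤 : Type*) [LieRing 𝔤] [LieAlgebra ℝ 𝔤] [FiniteDimensional ℝ 𝔤]
    (hdim : Module.finrank ℝ 𝔤 = 2 * n)
    (hunimod : IsUnimodularLie 𝔤) (hsolv : IsCompletelySolvableLie 𝔤)
    (Ω : LinearMap.BilinForm ℝ 𝔤) (J : 𝔤 →ₗ[ℝ] 𝔤)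
    (hΩ : IsSymplecticForm Ω) (hJ : IsComplexStructure J) (htame : Tames Ω J) :
    IsLieAbelian 𝔤 := by
  have : LieModule.IsTriangularizable ℝ 𝔤 𝔤 :=
    ⟨fun X => iSup_maxGenEigenspace_eq_top_of_complex_eigenvalues_real (hsolv X)⟩
  exact isLieAbelian_of_tames hunimod hΩ hJ htame
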